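/- A homogeneous stochastic trial-offer market has a finite non-empty set $\mathcal I$ of items, visibilities $v_j \ge 0$, qualities $q_j \in [0,1]$ with $v_j q_j > 0$ for every item $j$, and a feedback exponent $r \ge 0$. Let $d_j^t$ be the number of purchases of item $j$ up to time $t$ (the initial counts $d^0_j\in\mathbb N$ being deterministic) and let $\phi_j^t = d_j^t / \sum_k d_k^t$ be the market share, a point of the simplex $\Delta = \{\phi \in \mathbb R^{\mathcal I} : \phi_j \ge 0, \sum_j \phi_j = 1\}$. At each time $t \ge 1$ one user arrives; conditionally on the past, she tries item $j$ with probability $v_j (\phi_j^{t-1})^r / \sum_k v_k (\phi_k^{t-1})^r$, and she then purchases the item she tried, $j$ say, with probability $q_j$. For a market share $\phi$, let $y_j(\phi) = q_j v_j \phi_j^r / \sum_k v_k \phi_k^r$ and $p_j(\phi) = y_j(\phi) / \sum_k y_k(\phi)$, the probability that the next purchase is of item $j$. A trial-offer market equilibrium (TOME) is a $\phi \in \Delta$ with $p(\phi) = \phi$; it is interior if $\phi_j > 0$ for all $j$. Put $$\Psi(\phi) = \sum_{j} \bigl( \phi_j \log (q_j v_j) - (1-r)\, \phi_j \log \phi_j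 \bigr), \qquad 0 \log 0 = 0 .$$ Theorem. Assume that $\phi^0_j > 0$ for every item $j$. (i) If $0 \le r < 1$, then the market has a unique interior TOME $\phi^*$, and with probability $1$, $\lim_{t\to\infty} \phi^t = \phi^*$. (ii) If $0 \le r \le 1$, then $\Psi$ attains a maximum $\Psi^*$ on $\Delta$, and with probability $1$, $\lim_{t\to\infty} \Psi(\phi^t) = \Psi^*$. -/

import Mathlib

open MeasureTheory ProbabilityTheory Filter Topology

noncomputable section

/-- A homogeneous trial-offer market (a single user type) on a set `ι` of items: visibilities
`v j ≥ 0`, qualities `q j ∈ [0,1]` (the probability that an item is purchased once it has been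
tried), and the feedback exponent `r`. -/
structure TOMarket (ι : Type*) where
  v : ι → ℝ
  q : ι → ℝ
  r : ℝ
  v_nonneg : ∀ j, 0 ≤ v j
  q_nonneg : ∀ j, 0 ≤ q j
  q_le_one : ∀ j, q j ≤ 1

namespace TOMarket

variable {ι : Type*} [Fintype ι]

/-- The probability that the next user tries item `j`, given the current market share `φ`
(multinomial logit; it is `0` when the denominator vanishes). -/
def tryProb (M : TOMarket ι) (φ : ι → ℝ) (j : ι) : ℝ :=
  M.v j * φ j ^ M.r / ∑ k, M.v k * φ k ^ M.r

/-- The probability `y j` that the next user tries and then purchases item `j`. -/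
def buyProb (M : TOMarket ι) (φ : ι → ℝ) (j : ι) : ℝ :=
  M.q j * M.tryProb φ j

/-- The probability `p j` that the next purchase is of item `j`. -/
def nextPurchaseProb (M : TOMarket ι) (φ : ι → ℝ) (j : ι) : ℝ :=
  M.buyProb φ j / ∑ k, M.buyProb φ k

/-- A trial-offer market equilibrium: a market share (a point of the simplex) with `p φ = φ`. -/
def IsTOME (M : TOMarket ι) (φ : ι → ℝ) : Prop :=
  φ ∈ stdSimplex ℝ ι ∧ M.nextPurchaseProb φ = φ

/-- An interior trial-offer market equilibrium: all items have a positive share. -/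
def IsInteriorTOME (M : TOMarket ι) (φ : ι → ℝ) : Prop :=
  M.IsTOME φ ∧ ∀ j, 0 < φ j

/-- The objective `Ψ`: alternative efficiency plus `(1 - r)` times the Shannon entropy
(with `0 log 0 = 0`). -/
def Psi (M : TOMarket ι) (φ : ι → ℝ) : ℝ :=
  ∑ j, (φ j * Real.log (M.q j * M.v j) - (1 - M.r) * (φ j * Real.log (φ j)))

end TOMarket

/-- The market share that corresponds to the purchase counts `d`. -/
def marketShare {ι : Type*} [Fintype ι] (d : ι → ℕ) (j : ι) : ℝ :=
  (d j : ℝ) / ∑ k, (d k : ℝ)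

open scoped Classical in
/-- The purchase counts at time `t`: the initial count `d₀ j`, plus the number of the users
`1, …, t` who tried item `j` and bought it. Here `tried s` is the item tried by user `s`, and
`bought s` tells whether user `s` bought it; the values at `s = 0` play no role. -/
def purchases {ι Ω : Type*} (d₀ : ι → ℕ) (tried : ℕ → Ω → ι) (bought : ℕ → Ω → Bool)
    (t : ℕ) (ω : Ω) (j : ι) : ℕ :=
  d₀ j + ((Finset.Icc 1 t).filter fun s => tried s ω = j ∧ bought s ω = true).card

/-- The random market share `φ^t`. -/
def shareAt {ι Ω : Type*} [Fintype ι] (d₀ : ι → ℕ) (tried : ℕ → Ω → ι) (bought : ℕ → Ω → Bool)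
    (t : ℕ) (ω : Ω) : ι → ℝ :=
  marketShare (purchases d₀ tried bought t ω)

/-- The stochastic trial-offer dynamics of the market `M` with initial purchase counts `d₀`, where
`ℱ t` is the information available after user `t`. Conditionally on `ℱ t`, user `t + 1` tries item
`j` with the multinomial logit probability at the current market share, and an item `j` that has
been tried is purchased with probability `q j`. -/
structure IsTOProcess {ι Ω : Type*} [Fintype ι] {mΩ : MeasurableSpace Ω} (M : TOMarket ι) (d₀ : ι → ℕ)
    (μ : Measure Ω) (ℱ : Filtration ℕ mΩ)
    (tried : ℕ → Ω → ι) (bought : ℕ → Ω → Bool) : Prop where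
  measurable_tried : ∀ t j, MeasurableSet[ℱ (t + 1)] {ω | tried (t + 1) ω = j}
  measurable_bought : ∀ t, MeasurableSet[ℱ (t + 1)] {ω | bought (t + 1) ω = true}
  condProb_tried : ∀ t j,
    μ⟦{ω | tried (t + 1) ω = j} | ℱ t⟧
      =ᵐ[μ] fun ω => M.tryProb (shareAt d₀ tried bought t ω) j
  condProb_bought : ∀ t j,
    μ⟦{ω | tried (t + 1) ω = j ∧ bought (t + 1) ω = true} | ℱ t⟧
      =ᵐ[μ] fun ω => M.q j * M.tryProb (shareAt d₀ tried bought t ω) j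

end

/-! Write `w i = q i * v i` and let `d i` be the current count of item `i`. The next user buys `i`
with probability `w i * d i ^ r / A`, where `A` is the total attraction. Weighting each purchase of
`i` by `d i ^ (-r)` therefore gives an expected increment `w i / A`: apart from the factor `w i`, it
is the same for every item. Summing `1 / A` over time gives a random clock `T` common to all items,
and the weighted purchases of `i` sum to about `∫ x in 1..d i, x ^ (-r)`, with compensator `w i *
T`.

A strong law turns this into `(∫ x in 1..d i, x ^ (-r)) / T → w i` almost surely. The centred
increments divided by the clock form an L²-bounded martingale, since their conditional variances are
at most `w i * τ s / T (s + 1) ^ 2` with `τ s = T (s + 1) - T s`, a telescoping bound; Kronecker's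
lemma concludes, because `T` diverges when `r ≤ 1`. This is
`IsTOProcess.ae_tendsto_integral_div_marketClock`.

If `r < 1`, then `d i` is asymptotic to `((1 - r) * w i * T) ^ (1 / (1 - r))`, so the shares
converge to the normalised `w i ^ (1 / (1 - r))`, which Gibbs' inequality identifies as a maximiser
of `Ψ`. If `r = 1`, then `log (d i) / T → w i`: every item with non-maximal `w i` loses its share,
and `Ψ`, now linear, tends to `log (max w)`. -/

/-! ### Weighted averages, Kronecker's lemma and power sums. -/

section Deterministic

/-- The terms `τ s * (X s - L)` are `o(τ s)`, and this survives summation because the weights have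
divergent sum. -/
theorem tendsto_weighted_average {τ X : ℕ → ℝ} {L : ℝ} (hτ : ∀ s, 0 < τ s)
    (hT : Tendsto (fun t => ∑ s ∈ Finset.range t, τ s) atTop atTop)
    (hX : Tendsto X atTop (𝓝 L)) :
    Tendsto (fun t => (∑ s ∈ Finset.range t, τ s * X s) / ∑ s ∈ Finset.range t, τ s)
      atTop (𝓝 L) := by
  have h1 : (fun s => τ s * (X s - L)) =o[atTop] τ := by
    have : (fun s => X s - L) =o[atTop] (fun _ => (1 : ℝ)) := by
      rw [Asymptotics.isLittleO_one_iff]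
      simpa using hX.sub_const L
    simpa using (Asymptotics.isBigO_refl τ atTop).mul_isLittleO this
  have h2 := (h1.sum_range (fun n => (hτ n).le) hT).tendsto_div_nhds_zero
  have h3 := h2.add_const L
  rw [zero_add] at h3
  refine h3.congr' ?_
  filter_upwards [hT.eventually_gt_atTop 0] with t ht
  simp only [mul_sub, Finset.sum_sub_distrib, ← Finset.sum_mul]
  field_simp
  ring

/-- **Kronecker's lemma** with the weights `∑ s < t, τ s`. -/
theorem kronecker_tendsto_zero {τ x : ℕ → ℝ} {L : ℝ} (hτ : ∀ s, 0 < τ s)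
    (hT : Tendsto (fun t => ∑ s ∈ Finset.range t, τ s) atTop atTop)
    (hx : Tendsto (fun t => ∑ s ∈ Finset.range t, x s) atTop (𝓝 L)) :
    Tendsto (fun t => (∑ s ∈ Finset.range t, (∑ u ∈ Finset.range (s + 1), τ u) * x s) /
      ∑ s ∈ Finset.range t, τ s) atTop (𝓝 0) := by
  have h := hx.sub (tendsto_weighted_average hτ hT hx)
  rw [sub_self] at h
  refine h.congr' ?_
  filter_upwards [hT.eventually_gt_atTop 0] with t ht
  -- Summation by parts; after division, the right side is the partial sum of `x` minus a weighted
  -- average of such partial sums.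
  have key : ∀ t, ∑ s ∈ Finset.range t, (∑ u ∈ Finset.range (s + 1), τ u) * x s =
      (∑ s ∈ Finset.range t, τ s) * (∑ s ∈ Finset.range t, x s) -
        ∑ s ∈ Finset.range t, τ s * ∑ u ∈ Finset.range s, x u := by
    intro t
    induction t with
    | zero => simp
    | succ n ih => rw [Finset.sum_range_succ, ih]; simp only [Finset.sum_range_succ]; ring
  rw [key]
  field_simp

theorem sum_div_sq_partialSum_le {τ : ℕ → ℝ} (hτ : ∀ s, 0 < τ s) (t : ℕ) :
    ∑ s ∈ Finset.range t, τ s / (∑ u ∈ Finset.range (s + 1), τ u) ^ 2 ≤ 2 / τ 0 := by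
  have key : ∀ n, ∑ s ∈ Finset.range (n + 1), τ s / (∑ u ∈ Finset.range (s + 1), τ u) ^ 2 ≤
      2 / τ 0 - 1 / ∑ u ∈ Finset.range (n + 1), τ u := by
    intro n
    induction n with
    | zero =>
      have := hτ 0
      simp only [zero_add, Finset.sum_range_one]
      apply le_of_eq
      field_simp
      norm_num
    | succ n ih =>
      rw [Finset.sum_range_succ]
      have hpos : 0 < ∑ u ∈ Finset.range (n + 1), τ u :=
        Finset.sum_pos (fun i _ => hτ i) (by simp)
      have hs : ∑ u ∈ Finset.range (n + 1 + 1), τ u =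
        (∑ u ∈ Finset.range (n + 1), τ u) + τ (n + 1) := Finset.sum_range_succ _ _
      rw [hs]
      set A := ∑ u ∈ Finset.range (n + 1), τ u
      have hb := hτ (n + 1)
      -- Telescoping: lowering one factor of the square from `A + τ (n + 1)` to `A` gives exactly
      -- the right side.
      have : τ (n + 1) / (A + τ (n + 1)) ^ 2 ≤ 1 / A - 1 / (A + τ (n + 1)) := by
        rw [div_sub_div _ _ hpos.ne' (by positivity), div_le_div_iff₀ (by positivity) (by positivity)]
        nlinarith [mul_pos hb hb, mul_pos hpos hb, mul_pos (mul_pos hb hb) (add_pos hpos hb)]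
      linarith
  cases t with
  | zero => have := hτ 0; simp; positivity
  | succ n =>
    have hpos : 0 < ∑ u ∈ Finset.range (n + 1), τ u :=
      Finset.sum_pos (fun i _ => hτ i) (by simp)
    have := key n
    have h2 : 0 < 1 / ∑ u ∈ Finset.range (n + 1), τ u := by positivity
    linarith

theorem abs_sum_rpow_neg_sub_integral_le {r : ℝ} (hr : 0 ≤ r) {n : ℕ} (hn : 1 ≤ n) :
    |∑ k ∈ Finset.range n, (k : ℝ) ^ (-r) - ∫ x in (1 : ℝ)..n, x ^ (-r)| ≤ 2 := by
  have hanti : AntitoneOn (fun x : ℝ => x ^ (-r)) (Set.Icc ((1 : ℕ) : ℝ) n) := by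
    intro x hx y hy hxy
    have hx1 : (1 : ℝ) ≤ x := by simpa using hx.1
    exact Real.rpow_le_rpow_of_nonpos (by linarith) hxy (by linarith)
  have h1 := hanti.integral_le_sum_Ico hn
  have h2 := hanti.sum_le_integral_Ico hn
  -- The term at `k = 0` is `1` if `r = 0` and `0` otherwise; it costs one of the two units in the
  -- bound, the shift in `h4` the other.
  have h0 : (((0 : ℕ) : ℝ) ^ (-r)) ≤ 1 := by
    rcases eq_or_ne r 0 with h | h
    · simp [h]
    · simp [Real.zero_rpow (neg_ne_zero.2 h)]
  have h0' : 0 ≤ (((0 : ℕ) : ℝ) ^ (-r)) := by positivity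
  have h3 : ∑ k ∈ Finset.range n, (k : ℝ) ^ (-r) =
      ((0 : ℕ) : ℝ) ^ (-r) + ∑ k ∈ Finset.Ico 1 n, (k : ℝ) ^ (-r) := by
    rw [Finset.range_eq_Ico, Finset.sum_eq_sum_Ico_succ_bot (by omega)]
  have h4 : ∑ k ∈ Finset.Ico 1 n, (k : ℝ) ^ (-r) ≤
      1 + ∑ k ∈ Finset.Ico 1 n, (((k + 1 : ℕ) : ℝ)) ^ (-r) := by
    rw [Finset.sum_Ico_add' (fun k : ℕ => (k : ℝ) ^ (-r)) 1 n 1]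
    rcases eq_or_lt_of_le hn with h | h
    · subst h; simp
    · rw [Finset.sum_eq_sum_Ico_succ_bot h]
      have : ∑ k ∈ Finset.Ico (1 + 1) n, (k : ℝ) ^ (-r) ≤
        ∑ k ∈ Finset.Ico (1 + 1) (n + 1), (k : ℝ) ^ (-r) :=
        Finset.sum_le_sum_of_subset_of_nonneg
          (Finset.Ico_subset_Ico_right (by omega)) (fun _ _ _ => by positivity)
      simpa using this
  rw [h3, abs_le]
  simp only [Nat.cast_one] at h1 h2
  constructor <;> linarith

end Deterministic

/-! ### Convergence of sums of centred indicators. -/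

section Martingale

variable {Ω : Type*} {mΩ : MeasurableSpace Ω} {μ : Measure Ω}

theorem integral_mul_indicator_sub_condProb [IsProbabilityMeasure μ] {m : MeasurableSpace Ω}
    (hm : m ≤ mΩ) {B : Set Ω} (hB : MeasurableSet[mΩ] B) {p g : Ω → ℝ}
    (hp : μ⟦B | m⟧ =ᵐ[μ] p) (hpb : ∀ ω, |p ω| ≤ 1) (hpm : StronglyMeasurable[m] p)
    (hg : StronglyMeasurable[m] g) {C : ℝ} (hgb : ∀ ω, |g ω| ≤ C) :
    ∫ ω, g ω * (B.indicator (fun _ => (1 : ℝ)) ω - p ω) ∂μ = 0 := by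
  have hgi : Integrable g μ :=
    Integrable.of_bound (hg.mono hm).aestronglyMeasurable C (ae_of_all _ hgb)
  have hB1 : Integrable (B.indicator fun _ => (1 : ℝ)) μ :=
    (integrable_const 1).indicator hB
  have hgB : Integrable (g * B.indicator fun _ => (1 : ℝ)) μ :=
    hB1.bdd_mul (hg.mono hm).aestronglyMeasurable (ae_of_all _ hgb)
  have hgp : Integrable (fun ω => g ω * p ω) μ :=
    hgi.mul_bdd (hpm.mono hm).aestronglyMeasurable (ae_of_all _ hpb)
  have h1 := condExp_mul_of_stronglyMeasurable_left (μ := μ) hg hgB hB1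
  have h2 : ∫ ω, (g * B.indicator fun _ => (1 : ℝ)) ω ∂μ = ∫ ω, g ω * p ω ∂μ := by
    rw [← integral_condExp hm]
    refine integral_congr_ae ?_
    filter_upwards [h1, hp] with ω h h'
    rw [h, Pi.mul_apply, h']
  simp only [mul_sub]
  exact (integral_sub hgB hgp).trans (sub_eq_zero.2 h2)

/-- Bounded predictable multiples of centred indicators have almost surely convergent partial sums
when the sum of their conditional variances is bounded. -/
theorem ae_exists_tendsto_sum_mul_indicator_sub [IsProbabilityMeasure μ] {ℱ : Filtration ℕ mΩ}
    {B : ℕ → Set Ω} {p a : ℕ → Ω → ℝ} {C K : ℝ}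
    (hB : ∀ t, MeasurableSet[ℱ (t + 1)] (B t))
    (hp : ∀ t, μ⟦B t | ℱ t⟧ =ᵐ[μ] p t) (hp0 : ∀ t ω, 0 ≤ p t ω) (hp1 : ∀ t ω, p t ω ≤ 1)
    (hpm : ∀ t, StronglyMeasurable[ℱ t] (p t)) (ham : ∀ t, StronglyMeasurable[ℱ t] (a t))
    (hab : ∀ t ω, |a t ω| ≤ C)
    (hK : ∀ t ω, ∑ s ∈ Finset.range t, a s ω ^ 2 * p s ω ≤ K) :
    ∀ᵐ ω ∂μ, ∃ L, Tendsto (fun t => ∑ s ∈ Finset.range t,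
      a s ω * ((B s).indicator (fun _ => (1 : ℝ)) ω - p s ω)) atTop (𝓝 L) := by
  set ξ : ℕ → Ω → ℝ := fun s ω => a s ω * ((B s).indicator (fun _ => (1 : ℝ)) ω - p s ω) with hξ
  set X : ℕ → Ω → ℝ := fun t ω => ∑ s ∈ Finset.range t, ξ s ω with hX
  have hpabs : ∀ t ω, |p t ω| ≤ 1 := fun t ω => abs_le.2 ⟨by linarith [hp0 t ω], hp1 t ω⟩
  have hdiff : ∀ s ω, |(B s).indicator (fun _ => (1 : ℝ)) ω - p s ω| ≤ 1 := by
    intro s ω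
    have h0 := hp0 s ω
    have h1 := hp1 s ω
    by_cases h : ω ∈ B s <;> simp only [Set.indicator_of_mem, Set.indicator_of_notMem, h,
      not_false_eq_true] <;> rw [abs_le] <;> constructor <;> linarith
  have hξb : ∀ s ω, |ξ s ω| ≤ C := fun s ω => by
    rw [hξ, abs_mul]
    have := mul_le_mul (hab s ω) (hdiff s ω) (abs_nonneg _) ((abs_nonneg _).trans (hab s ω))
    simpa using this
  have hξm : ∀ s, StronglyMeasurable[ℱ (s + 1)] (ξ s) := fun s =>
    ((ham s).mono (ℱ.mono (Nat.le_succ s))).mul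
      ((stronglyMeasurable_const.indicator (hB s)).sub ((hpm s).mono (ℱ.mono (Nat.le_succ s))))
  have hXm : StronglyAdapted ℱ X := fun t =>
    Finset.stronglyMeasurable_fun_sum _ fun s hs =>
      (hξm s).mono (ℱ.mono (by have := Finset.mem_range.1 hs; omega))
  have hXb : ∀ t ω, |X t ω| ≤ t * C := fun t ω => by
    refine (Finset.abs_sum_le_sum_abs _ _).trans ?_
    simpa using Finset.sum_le_sum fun s (_ : s ∈ Finset.range t) => hξb s ω
  have hint : ∀ {f : Ω → ℝ} {t : ℕ} {D : ℝ}, StronglyMeasurable[ℱ t] f → (∀ ω, |f ω| ≤ D) →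
      Integrable f μ := fun {f t D} hf hD =>
    Integrable.of_bound (hf.mono (ℱ.le t)).aestronglyMeasurable D (ae_of_all _ hD)
  have hXi : ∀ t, Integrable (X t) μ := fun t => hint (hXm t) (hXb t)
  have hξi : ∀ t, Integrable (ξ t) μ := fun t => hint (hξm t) (hξb t)
  have hsucc : ∀ t, X (t + 1) = fun ω => X t ω + ξ t ω := fun t => by
    ext ω; simp only [hX, Finset.sum_range_succ]
  have horth : ∀ t (g : Ω → ℝ) (D : ℝ), StronglyMeasurable[ℱ t] g → (∀ ω, |g ω| ≤ D) →
      ∫ ω, g ω * ((B t).indicator (fun _ => (1 : ℝ)) ω - p t ω) ∂μ = 0 := fun t g D hg hD =>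
    integral_mul_indicator_sub_condProb (ℱ.le t) (ℱ.le _ _ (hB t)) (hp t) (hpabs t) (hpm t) hg hD
  have hmart : Martingale X ℱ μ := by
    refine martingale_of_setIntegral_eq_succ hXm hXi fun t s hs => ?_
    rw [hsucc, integral_add (hXi t).integrableOn (hξi t).integrableOn, left_eq_add,
      ← integral_indicator (ℱ.le _ _ hs)]
    rw [← horth t (s.indicator (a t)) C ((ham t).indicator hs) fun ω => ?_]
    · refine integral_congr_ae (ae_of_all _ fun ω => ?_)
      by_cases h : ω ∈ s <;> simp [h, hξ]
    · by_cases h : ω ∈ s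
      · simpa [h] using hab t ω
      · simpa [h] using (abs_nonneg _).trans (hab t ω)
  have hapm : ∀ t, StronglyMeasurable[ℱ t] fun ω => a t ω ^ 2 * p t ω := fun t =>
    ((ham t).pow 2).mul (hpm t)
  have hasq : ∀ t ω, a t ω ^ 2 ≤ C ^ 2 := fun t ω => sq_le_sq' (abs_le.1 (hab t ω)).1
    (abs_le.1 (hab t ω)).2
  have hapi : ∀ t, Integrable (fun ω => a t ω ^ 2 * p t ω) μ := fun t =>
    hint (D := C ^ 2) (hapm t) fun ω => by
      rw [abs_of_nonneg (mul_nonneg (sq_nonneg _) (hp0 t ω))]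
      nlinarith [hasq t ω, hp0 t ω, hp1 t ω, sq_nonneg (a t ω)]
  have hsqi : ∀ {f : Ω → ℝ} {t : ℕ} {D : ℝ}, StronglyMeasurable[ℱ t] f → (∀ ω, |f ω| ≤ D) →
      Integrable (fun ω => f ω ^ 2) μ := fun {f t D} hf hD =>
    hint (D := D ^ 2) (hf.pow 2) fun ω => by
      rw [abs_pow]; exact pow_le_pow_left₀ (abs_nonneg _) (hD ω) 2
  have hvar : ∀ t, ∫ ω, ξ t ω ^ 2 ∂μ ≤ ∫ ω, a t ω ^ 2 * p t ω ∂μ := by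
    intro t
    -- For an indicator `b`, `(b - p) ^ 2 = (1 - 2 * p) * (b - p) + p - p ^ 2`. The first term
    -- integrates to zero against the predictable factor `a ^ 2`, which leaves at most `a ^ 2 * p`.
    have hg : StronglyMeasurable[ℱ t] fun ω => a t ω ^ 2 * (1 - 2 * p t ω) :=
      ((ham t).pow 2).mul (stronglyMeasurable_const.sub (stronglyMeasurable_const.mul (hpm t)))
    have hgb : ∀ ω, |a t ω ^ 2 * (1 - 2 * p t ω)| ≤ C ^ 2 := fun ω => by
      have h1 : |1 - 2 * p t ω| ≤ 1 := abs_le.2 ⟨by linarith [hp1 t ω], by linarith [hp0 t ω]⟩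
      rw [abs_mul, abs_of_nonneg (sq_nonneg (a t ω))]
      nlinarith [hasq t ω, sq_nonneg (a t ω)]
    have h0 := horth t _ _ hg hgb
    have hi : Integrable (fun ω => a t ω ^ 2 * (1 - 2 * p t ω) *
        ((B t).indicator (fun _ => (1 : ℝ)) ω - p t ω)) μ := by
      refine hint (t := t + 1) (D := C ^ 2) ((hg.mono (ℱ.mono (Nat.le_succ t))).mul
        ((stronglyMeasurable_const.indicator (hB t)).sub
          ((hpm t).mono (ℱ.mono (Nat.le_succ t))))) fun ω => ?_
      rw [abs_mul]
      nlinarith [hgb ω, hdiff t ω, abs_nonneg (a t ω ^ 2 * (1 - 2 * p t ω))]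
    calc ∫ ω, ξ t ω ^ 2 ∂μ
        ≤ ∫ ω, (a t ω ^ 2 * (1 - 2 * p t ω) *
          ((B t).indicator (fun _ => (1 : ℝ)) ω - p t ω) + a t ω ^ 2 * p t ω) ∂μ := by
          refine integral_mono (hsqi (hξm t) (hξb t)) (hi.add (hapi t)) fun ω => ?_
          have : 0 ≤ a t ω ^ 2 * p t ω ^ 2 := by positivity
          by_cases h : ω ∈ B t <;> simp only [hξ, Set.indicator_of_mem, Set.indicator_of_notMem, h,
            not_false_eq_true] <;> nlinarith
      _ = ∫ ω, a t ω ^ 2 * p t ω ∂μ := by rw [integral_add hi (hapi t), h0, zero_add]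
  have hcross : ∀ t, ∫ ω, X t ω * ξ t ω ∂μ = 0 := by
    intro t
    rw [← horth t (fun ω => X t ω * a t ω) (t * C * C) ((hXm t).mul (ham t)) fun ω => ?_]
    · simp only [hξ, mul_assoc]
    · rw [abs_mul]
      exact mul_le_mul (hXb t ω) (hab t ω) (abs_nonneg _) ((abs_nonneg _).trans (hXb t ω))
  have hL2 : ∀ t, ∫ ω, X t ω ^ 2 ∂μ ≤ ∫ ω, ∑ s ∈ Finset.range t, a s ω ^ 2 * p s ω ∂μ := by
    intro t
    induction t with
    | zero => simp [hX]
    | succ t ih =>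
      have e1 : ∫ ω, X (t + 1) ω ^ 2 ∂μ =
          ∫ ω, X t ω ^ 2 ∂μ + 2 * ∫ ω, X t ω * ξ t ω ∂μ + ∫ ω, ξ t ω ^ 2 ∂μ := by
        have hXξ : Integrable (fun ω => X t ω * ξ t ω) μ :=
          (hξi t).bdd_mul ((hXm t).mono (ℱ.le t)).aestronglyMeasurable (ae_of_all _ (hXb t))
        have hX2 := hsqi (hXm t) (hXb t)
        have hsum : Integrable (fun ω => X t ω ^ 2 + 2 * (X t ω * ξ t ω)) μ :=
          hX2.add (hXξ.const_mul 2)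
        rw [← integral_const_mul, ← integral_add hX2 (hXξ.const_mul 2),
          ← integral_add hsum (hsqi (hξm t) (hξb t))]
        refine integral_congr_ae (ae_of_all _ fun ω => ?_)
        simp only [hsucc]
        ring
      rw [e1, hcross, mul_zero, add_zero]
      simp only [Finset.sum_range_succ]
      rw [integral_add (integrable_finsetSum _ fun s _ => hapi s) (hapi t)]
      exact add_le_add ih (hvar t)
  -- The variance bound `K` controls the L¹ norm through `|x| ≤ 1 + x ^ 2`.
  refine hmart.submartingale.exists_ae_tendsto_of_bdd (R := (1 + K).toNNReal) fun t => ?_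
  rw [eLpNorm_one_eq_lintegral_enorm, ← ofReal_integral_norm_eq_lintegral_enorm (hXi t)]
  refine ENNReal.ofReal_le_ofReal ?_
  calc ∫ ω, ‖X t ω‖ ∂μ ≤ ∫ ω, (1 + X t ω ^ 2) ∂μ := by
        refine integral_mono (hXi t).norm ((integrable_const 1).add (hsqi (hXm t) (hXb t)))
          fun ω => ?_
        simp only [Real.norm_eq_abs]
        nlinarith [sq_abs (X t ω), sq_nonneg (|X t ω| - 1)]
    _ = 1 + ∫ ω, X t ω ^ 2 ∂μ := by
        rw [integral_add (integrable_const 1) (hsqi (hXm t) (hXb t))]; simp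
    _ ≤ 1 + K := by
        gcongr
        refine (hL2 t).trans ?_
        calc _ ≤ ∫ _, K ∂μ := integral_mono (integrable_finsetSum _ fun s _ => hapi s)
              (integrable_const K) (hK t)
          _ = K := by simp

end Martingale

/-! ### The interior equilibrium and the maximum of `Ψ`. -/

namespace TOMarket

variable {ι : Type*} {M : TOMarket ι}

theorem v_pos (hM : ∀ j, 0 < M.v j * M.q j) (j : ι) : 0 < M.v j :=
  pos_of_mul_pos_left (hM j) (M.q_nonneg j)

theorem q_mul_v_pos (hM : ∀ j, 0 < M.v j * M.q j) (j : ι) : 0 < M.q j * M.v j :=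
  mul_comm (M.v j) (M.q j) ▸ hM j

variable [Fintype ι]

/-- The total attraction `∑ k, v k * d k ^ r` of the items at the purchase counts `d`. -/
noncomputable def attraction (M : TOMarket ι) (d : ι → ℕ) : ℝ :=
  ∑ k, M.v k * (d k : ℝ) ^ M.r

theorem attraction_pos [Nonempty ι] (hM : ∀ j, 0 < M.v j * M.q j) {d : ι → ℕ}
    (hd : ∀ j, 0 < d j) : 0 < M.attraction d :=
  Finset.sum_pos (fun k _ => mul_pos (v_pos hM k)
    (Real.rpow_pos_of_pos (Nat.cast_pos.2 (hd k)) _)) Finset.univ_nonempty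

/-- By homogeneity, the total count to the power `r` cancels, so raw counts can replace shares. -/
theorem tryProb_marketShare [Nonempty ι] {d : ι → ℕ} (hd : ∀ j, 0 < d j) (j : ι) :
    M.tryProb (marketShare d) j = M.v j * (d j : ℝ) ^ M.r / M.attraction d := by
  have hD : 0 < ∑ k, (d k : ℝ) :=
    Finset.sum_pos (fun k _ => Nat.cast_pos.2 (hd k)) Finset.univ_nonempty
  simp only [tryProb, marketShare, attraction]
  simp_rw [Real.div_rpow (Nat.cast_nonneg _) hD.le, ← mul_div_assoc, ← Finset.sum_div]
  rw [div_div_div_cancel_right₀ (Real.rpow_pos_of_pos hD _).ne']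

theorem nextPurchaseProb_eq [Nonempty ι] (hM : ∀ j, 0 < M.v j * M.q j) {φ : ι → ℝ}
    (hφ : ∀ j, 0 < φ j) (j : ι) :
    M.nextPurchaseProb φ j =
      M.q j * M.v j * φ j ^ M.r / ∑ k, M.q k * M.v k * φ k ^ M.r := by
  have hD : 0 < ∑ k, M.v k * φ k ^ M.r :=
    Finset.sum_pos (fun k _ => mul_pos (v_pos hM k) (Real.rpow_pos_of_pos (hφ k) _))
      Finset.univ_nonempty
  simp only [nextPurchaseProb, buyProb, tryProb]
  simp_rw [← mul_div_assoc, ← Finset.sum_div, ← mul_assoc]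
  rw [div_div_div_cancel_right₀ hD.ne']

/-- The interior equilibrium for `r < 1`: shares proportional to `(q j * v j) ^ (1 / (1 - r))`. -/
noncomputable def interiorShare (M : TOMarket ι) (j : ι) : ℝ :=
  (M.q j * M.v j) ^ (1 / (1 - M.r)) / ∑ k, (M.q k * M.v k) ^ (1 / (1 - M.r))

theorem sum_rpow_pos [Nonempty ι] (hM : ∀ j, 0 < M.v j * M.q j) (s : ℝ) :
    0 < ∑ k, (M.q k * M.v k) ^ s :=
  Finset.sum_pos (fun k _ => Real.rpow_pos_of_pos (q_mul_v_pos hM k) _) Finset.univ_nonempty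

theorem interiorShare_pos [Nonempty ι] (hM : ∀ j, 0 < M.v j * M.q j) (j : ι) :
    0 < M.interiorShare j :=
  div_pos (Real.rpow_pos_of_pos (q_mul_v_pos hM j) _) (sum_rpow_pos hM _)

theorem interiorShare_mem_stdSimplex [Nonempty ι] (hM : ∀ j, 0 < M.v j * M.q j) :
    M.interiorShare ∈ stdSimplex ℝ ι := by
  refine ⟨fun j => (interiorShare_pos hM j).le, ?_⟩
  simp only [interiorShare]
  rw [← Finset.sum_div, div_self (sum_rpow_pos hM _).ne']

/-- Inverts the formula for the equilibrium; both the fixed-point equation and the rewriting of `Ψ`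
rest on it. -/
theorem q_mul_v_eq_interiorShare [Nonempty ι] (hM : ∀ j, 0 < M.v j * M.q j) (hr : M.r < 1)
    (j : ι) : M.q j * M.v j =
      (∑ k, (M.q k * M.v k) ^ (1 / (1 - M.r))) ^ (1 - M.r) * M.interiorShare j ^ (1 - M.r) := by
  have h1 : 1 - M.r ≠ 0 := by linarith
  have hZ := sum_rpow_pos hM (1 / (1 - M.r))
  rw [← Real.mul_rpow hZ.le (interiorShare_pos hM j).le, interiorShare,
    mul_div_cancel₀ _ hZ.ne', ← Real.rpow_mul (q_mul_v_pos hM j).le, one_div_mul_cancel h1,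
    Real.rpow_one]

theorem isInteriorTOME_interiorShare [Nonempty ι] (hM : ∀ j, 0 < M.v j * M.q j)
    (hr : M.r < 1) : M.IsInteriorTOME M.interiorShare := by
  refine ⟨⟨interiorShare_mem_stdSimplex hM, ?_⟩, interiorShare_pos hM⟩
  ext j
  rw [nextPurchaseProb_eq hM (interiorShare_pos hM)]
  set Z := ∑ k, (M.q k * M.v k) ^ (1 / (1 - M.r))
  have hZ : 0 < Z ^ (1 - M.r) := Real.rpow_pos_of_pos (sum_rpow_pos hM _) _
  have key : ∀ k, M.q k * M.v k * M.interiorShare k ^ M.r = Z ^ (1 - M.r) * M.interiorShare k := by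
    intro k
    rw [q_mul_v_eq_interiorShare hM hr k, mul_assoc, ← Real.rpow_add (interiorShare_pos hM k),
      sub_add_cancel, Real.rpow_one]
  simp_rw [key, ← Finset.mul_sum]
  rw [(interiorShare_mem_stdSimplex hM).2, mul_one, mul_div_cancel_left₀ _ hZ.ne']

theorem IsInteriorTOME.eq_interiorShare [Nonempty ι] (hM : ∀ j, 0 < M.v j * M.q j)
    (hr : M.r < 1) {φ : ι → ℝ} (h : M.IsInteriorTOME φ) : φ = M.interiorShare := by
  obtain ⟨⟨hφ, hfix⟩, hpos⟩ := h
  have h1 : 1 - M.r ≠ 0 := by linarith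
  set K := ∑ k, M.q k * M.v k * φ k ^ M.r with hK
  have hKpos : 0 < K := Finset.sum_pos (fun k _ => mul_pos (q_mul_v_pos hM k)
    (Real.rpow_pos_of_pos (hpos k) _)) Finset.univ_nonempty
  have key : ∀ j, (M.q j * M.v j) ^ (1 / (1 - M.r)) = K ^ (1 / (1 - M.r)) * φ j := by
    intro j
    have e1 : M.q j * M.v j * φ j ^ M.r = K * φ j := by
      have := congrFun hfix j
      rw [nextPurchaseProb_eq hM hpos, div_eq_iff hKpos.ne'] at this
      rw [this, mul_comm]
    have e2 : M.q j * M.v j = K * φ j ^ (1 - M.r) := by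
      rw [Real.rpow_sub (hpos j), Real.rpow_one, ← mul_div_assoc, ← e1,
        mul_div_cancel_right₀ _ (Real.rpow_pos_of_pos (hpos j) _).ne']
    rw [e2, Real.mul_rpow hKpos.le (Real.rpow_nonneg (hpos j).le _),
      ← Real.rpow_mul (hpos j).le, mul_one_div_cancel h1, Real.rpow_one]
  ext j
  simp only [interiorShare]
  simp_rw [key, ← Finset.mul_sum]
  rw [hφ.2, mul_one, mul_div_cancel_left₀ _ (Real.rpow_pos_of_pos hKpos _).ne']

theorem continuous_Psi (M : TOMarket ι) : Continuous M.Psi := by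
  unfold Psi
  refine continuous_finsetSum _ fun j _ => ?_
  exact ((continuous_apply j).mul continuous_const).sub
    (continuous_const.mul (Real.continuous_mul_log.comp (continuous_apply j)))

/-- **Gibbs' inequality**. -/
theorem sum_mul_log_sub_mul_log_nonpos {φ ψ : ι → ℝ} (hφ : φ ∈ stdSimplex ℝ ι)
    (hψ : ψ ∈ stdSimplex ℝ ι) (hpos : ∀ j, 0 < ψ j) :
    ∑ j, (φ j * Real.log (ψ j) - φ j * Real.log (φ j)) ≤ 0 := by
  have h : ∀ j, φ j * Real.log (ψ j) - φ j * Real.log (φ j) ≤ ψ j - φ j := by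
    intro j
    rcases (hφ.1 j).eq_or_lt with h | h
    · rw [← h]; simpa using (hpos j).le
    · have := Real.log_le_sub_one_of_pos (div_pos (hpos j) h)
      rw [Real.log_div (hpos j).ne' h.ne'] at this
      calc _ = φ j * (Real.log (ψ j) - Real.log (φ j)) := by ring
        _ ≤ φ j * (ψ j / φ j - 1) := by gcongr
        _ = ψ j - φ j := by field_simp
  refine (Finset.sum_le_sum fun j _ => h j).trans ?_
  rw [Finset.sum_sub_distrib, hφ.2, hψ.2, sub_self]

theorem Psi_le_Psi_interiorShare [Nonempty ι] (hM : ∀ j, 0 < M.v j * M.q j) (hr : M.r < 1)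
    {φ : ι → ℝ} (hφ : φ ∈ stdSimplex ℝ ι) : M.Psi φ ≤ M.Psi M.interiorShare := by
  set Z := ∑ k, (M.q k * M.v k) ^ (1 / (1 - M.r))
  have hZ : 0 < Z := sum_rpow_pos hM _
  have hψ := interiorShare_mem_stdSimplex hM
  have hpos := interiorShare_pos hM
  -- On the simplex, `Ψ` is a constant minus `1 - r` times the relative entropy with respect to the
  -- interior equilibrium.
  have key : ∀ χ ∈ stdSimplex ℝ ι, M.Psi χ = (1 - M.r) * Real.log Z +
      (1 - M.r) * ∑ j, (χ j * Real.log (M.interiorShare j) - χ j * Real.log (χ j)) := by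
    intro χ hχ
    have hlog : ∀ j, Real.log (M.q j * M.v j) =
        (1 - M.r) * Real.log Z + (1 - M.r) * Real.log (M.interiorShare j) := by
      intro j
      rw [q_mul_v_eq_interiorShare hM hr j,
        Real.log_mul (Real.rpow_pos_of_pos hZ _).ne' (Real.rpow_pos_of_pos (hpos j) _).ne',
        Real.log_rpow hZ, Real.log_rpow (hpos j)]
    calc M.Psi χ = ∑ j, (χ j * ((1 - M.r) * Real.log Z) +
          (1 - M.r) * (χ j * Real.log (M.interiorShare j) - χ j * Real.log (χ j))) := by
            refine Finset.sum_congr rfl fun j _ => ?_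
            rw [hlog]; ring
      _ = _ := by rw [Finset.sum_add_distrib, ← Finset.sum_mul, hχ.2, one_mul, ← Finset.mul_sum]
  rw [key φ hφ, key _ hψ]
  have := sum_mul_log_sub_mul_log_nonpos hφ hψ hpos
  simp only [sub_self, Finset.sum_const_zero, mul_zero, add_zero]
  have h1 : 0 < 1 - M.r := by linarith
  nlinarith

theorem Psi_eq_of_r_eq_one (hr : M.r = 1) (φ : ι → ℝ) :
    M.Psi φ = ∑ j, φ j * Real.log (M.q j * M.v j) := by
  simp [Psi, hr]

theorem isGreatest_Psi_of_r_eq_one (hM : ∀ j, 0 < M.v j * M.q j) (hr : M.r = 1) {m : ι}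
    (hm : ∀ j, M.q j * M.v j ≤ M.q m * M.v m) :
    IsGreatest (M.Psi '' stdSimplex ℝ ι) (Real.log (M.q m * M.v m)) := by
  classical
  constructor
  · refine ⟨Pi.single m 1, single_mem_stdSimplex ℝ m, ?_⟩
    rw [Psi_eq_of_r_eq_one hr, Finset.sum_eq_single m] <;> simp +contextual
  · rintro _ ⟨φ, hφ, rfl⟩
    rw [Psi_eq_of_r_eq_one hr]
    calc _ ≤ ∑ j, φ j * Real.log (M.q m * M.v m) := Finset.sum_le_sum fun j _ =>
          mul_le_mul_of_nonneg_left (Real.log_le_log (q_mul_v_pos hM j) (hm j)) (hφ.1 j)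
      _ = _ := by rw [← Finset.sum_mul, hφ.2, one_mul]

end TOMarket

/-! ### From growth of counts to limits of shares. -/

theorem marketShare_mem_stdSimplex {ι : Type*} [Fintype ι] [Nonempty ι] {d : ι → ℕ}
    (hd : ∀ j, 0 < d j) : marketShare d ∈ stdSimplex ℝ ι := by
  have hD : 0 < ∑ k, (d k : ℝ) :=
    Finset.sum_pos (fun k _ => Nat.cast_pos.2 (hd k)) Finset.univ_nonempty
  refine ⟨fun j => by unfold marketShare; positivity, ?_⟩
  simp only [marketShare]
  rw [← Finset.sum_div, div_self hD.ne']

theorem pos_of_marketShare_pos {ι : Type*} [Fintype ι] {d : ι → ℕ} {j : ι}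
    (h : 0 < marketShare d j) : 0 < d j := by
  rw [Nat.pos_iff_ne_zero]
  rintro h0
  simp [marketShare, h0] at h

/-- If the counts grow like a common power of `T`, the shares converge. -/
theorem tendsto_marketShare_of_rpow_growth {ι : Type*} [Fintype ι] [Nonempty ι] {M : TOMarket ι}
    (hM : ∀ j, 0 < M.v j * M.q j) (hr : M.r < 1) {d : ℕ → ι → ℕ} {T : ℕ → ℝ}
    (hT : Tendsto T atTop atTop)
    (h : ∀ j, Tendsto (fun t => (∫ x in (1 : ℝ)..d t j, x ^ (-M.r)) / T t) atTop
      (𝓝 (M.q j * M.v j))) :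
    Tendsto (fun t => marketShare (d t)) atTop (𝓝 M.interiorShare) := by
  have h1 : 0 < 1 - M.r := by linarith
  set s := 1 / (1 - M.r) with hs
  have hs0 : 0 < s := by positivity
  have key : ∀ j, Tendsto (fun t => (d t j : ℝ) / ((1 - M.r) * T t) ^ s) atTop
      (𝓝 ((M.q j * M.v j) ^ s)) := by
    intro j
    have h2 : Tendsto (fun t => (d t j : ℝ) ^ (1 - M.r) / ((1 - M.r) * T t)) atTop
        (𝓝 (M.q j * M.v j)) := by
      -- The integral is `(d ^ (1 - r) - 1) / (1 - r)`; the added term restores the lower endpoint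
      -- and is negligible against `T`.
      have h3 := (h j).add (tendsto_const_nhds (x := (1 / (1 - M.r))) |>.div_atTop hT)
      rw [add_zero] at h3
      refine h3.congr' ?_
      filter_upwards [hT.eventually_gt_atTop 0] with t ht
      rw [integral_rpow (Or.inl (by linarith)), neg_add_eq_sub, Real.one_rpow]
      field_simp
      ring
    refine (h2.rpow_const (p := s) (Or.inr hs0.le)).congr' ?_
    filter_upwards [hT.eventually_gt_atTop 0] with t ht
    rw [Real.div_rpow (by positivity) (by positivity), ← Real.rpow_mul (by positivity), hs,
      mul_one_div_cancel h1.ne', Real.rpow_one]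
  rw [tendsto_pi_nhds]
  intro j
  have := (key j).div (tendsto_finsetSum Finset.univ fun k _ => key k)
    (TOMarket.sum_rpow_pos hM s).ne'
  refine this.congr' ?_
  filter_upwards [hT.eventually_gt_atTop 0] with t ht
  simp only [Pi.div_apply, ← Finset.sum_div, marketShare]
  rw [div_div_div_cancel_right₀ (Real.rpow_pos_of_pos (by positivity) _).ne']

/-- If the logarithms of the counts grow like multiples of `T`, the share of an item with a smaller
factor vanishes. -/
theorem tendsto_marketShare_zero_of_log_growth {ι : Type*} [Fintype ι] {d : ℕ → ι → ℕ}
    {T : ℕ → ℝ} (hT : Tendsto T atTop atTop) (hd : ∀ t j, 0 < d t j) {i m : ι} {a b : ℝ}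
    (hab : a < b) (hi : Tendsto (fun t => Real.log (d t i) / T t) atTop (𝓝 a))
    (hm : Tendsto (fun t => Real.log (d t m) / T t) atTop (𝓝 b)) :
    Tendsto (fun t => marketShare (d t) i) atTop (𝓝 0) := by
  have h1 : Tendsto (fun t => (Real.log (d t i) / T t - Real.log (d t m) / T t) * T t) atTop
      atBot := (hi.sub hm).neg_mul_atTop (by linarith) hT
  refine squeeze_zero' (Eventually.of_forall fun t => by unfold marketShare; positivity) ?_
    (Real.tendsto_exp_atBot.comp h1)
  filter_upwards [hT.eventually_gt_atTop 0] with t ht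
  have hi0 : (0 : ℝ) < d t i := Nat.cast_pos.2 (hd t i)
  have hm0 : (0 : ℝ) < d t m := Nat.cast_pos.2 (hd t m)
  have : (Real.log (d t i) / T t - Real.log (d t m) / T t) * T t =
      Real.log (d t i) - Real.log (d t m) := by field_simp
  rw [Function.comp_apply, this, Real.exp_sub, Real.exp_log hi0, Real.exp_log hm0, marketShare]
  exact div_le_div_of_nonneg_left hi0.le hm0
    (Finset.single_le_sum (f := fun k => (d t k : ℝ)) (fun k _ => Nat.cast_nonneg _)
      (Finset.mem_univ m))

theorem TOMarket.tendsto_Psi_of_r_eq_one {ι : Type*} [Fintype ι] {M : TOMarket ι} (hr : M.r = 1)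
    {m : ι} (hm : ∀ j, M.q j * M.v j ≤ M.q m * M.v m) {φ : ℕ → ι → ℝ}
    (hφ : ∀ t, φ t ∈ stdSimplex ℝ ι)
    (h : ∀ j, M.q j * M.v j < M.q m * M.v m → Tendsto (fun t => φ t j) atTop (𝓝 0)) :
    Tendsto (fun t => M.Psi (φ t)) atTop (𝓝 (Real.log (M.q m * M.v m))) := by
  have e : ∀ t, M.Psi (φ t) = Real.log (M.q m * M.v m) +
      ∑ j, φ t j * (Real.log (M.q j * M.v j) - Real.log (M.q m * M.v m)) := fun t => by
    simp only [Psi_eq_of_r_eq_one hr, mul_sub, Finset.sum_sub_distrib, ← Finset.sum_mul, (hφ t).2]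
    ring
  simp_rw [e]
  have h0 : Tendsto (fun t => ∑ j, φ t j * (Real.log (M.q j * M.v j) -
      Real.log (M.q m * M.v m))) atTop (𝓝 (∑ _j : ι, 0)) := by
    refine tendsto_finsetSum _ fun j _ => ?_
    rcases (hm j).lt_or_eq with hj | hj
    · simpa using (h j hj).mul_const (Real.log (M.q j * M.v j) - Real.log (M.q m * M.v m))
    · simp [hj]
  simpa using h0.const_add (Real.log (M.q m * M.v m))

/-! ### Purchase counts as a process. -/

section Purchases

variable {ι Ω : Type*} {d₀ : ι → ℕ} {tried : ℕ → Ω → ι} {bought : ℕ → Ω → Bool}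

theorem purchases_zero (ω : Ω) : purchases d₀ tried bought 0 ω = d₀ := by
  ext j
  simp [purchases]

open scoped Classical in
theorem purchases_succ (t : ℕ) (ω : Ω) (j : ι) :
    purchases d₀ tried bought (t + 1) ω j = purchases d₀ tried bought t ω j +
      if tried (t + 1) ω = j ∧ bought (t + 1) ω = true then 1 else 0 := by
  unfold purchases
  rw [← Finset.insert_Icc_right_eq_Icc_add_one (by omega), Finset.filter_insert]
  split_ifs with h
  · rw [Finset.card_insert_of_notMem (by simp), add_assoc]
  · simp

theorem purchases_pos (hd₀ : ∀ j, 0 < d₀ j) (t : ℕ) (ω : Ω) (j : ι) :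
    0 < purchases d₀ tried bought t ω j :=
  (hd₀ j).trans_le (Nat.le_add_right _ _)

theorem purchases_le (t : ℕ) (ω : Ω) (j : ι) :
    purchases d₀ tried bought t ω j ≤ d₀ j + t := by
  classical
  induction t with
  | zero => simp [purchases_zero]
  | succ t ih => rw [purchases_succ]; split_ifs <;> omega

/-- Each purchase of `j` raises its count by one, so the values of `f` collected at purchase times
are those at consecutive integers. -/
theorem sum_range_purchases_sub (f : ℕ → ℝ) (t : ℕ) (ω : Ω) (j : ι) :
    ∑ s ∈ Finset.range t, f (purchases d₀ tried bought s ω j) *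
      {ω | tried (s + 1) ω = j ∧ bought (s + 1) ω = true}.indicator (fun _ => (1 : ℝ)) ω =
    ∑ k ∈ Finset.range (purchases d₀ tried bought t ω j), f k -
      ∑ k ∈ Finset.range (d₀ j), f k := by
  classical
  induction t with
  | zero => simp [purchases_zero]
  | succ t ih =>
    rw [Finset.sum_range_succ, ih, purchases_succ]
    by_cases h : tried (t + 1) ω = j ∧ bought (t + 1) ω = true
    · rw [if_pos h, Set.indicator_of_mem (by exact h), Finset.sum_range_succ]
      ring
    · rw [if_neg h, Set.indicator_of_notMem (by exact h)]
      simp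

end Purchases

namespace IsTOProcess

variable {ι Ω : Type*} [Fintype ι] {mΩ : MeasurableSpace Ω} {M : TOMarket ι} {d₀ : ι → ℕ}
  {μ : Measure Ω} {ℱ : Filtration ℕ mΩ} {tried : ℕ → Ω → ι} {bought : ℕ → Ω → Bool}

theorem measurableSet_purchase (h : IsTOProcess M d₀ μ ℱ tried bought) (t : ℕ) (j : ι) :
    MeasurableSet[ℱ (t + 1)] {ω | tried (t + 1) ω = j ∧ bought (t + 1) ω = true} :=
  (h.measurable_tried t j).inter (h.measurable_bought t)

theorem measurable_purchases (h : IsTOProcess M d₀ μ ℱ tried bought) (t : ℕ) :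
    Measurable[ℱ t] (purchases d₀ tried bought t) := by
  classical
  refine @measurable_pi_lambda Ω ι (fun _ => ℕ) (ℱ t) _ _ fun j => ?_
  induction t with
  | zero => simp only [purchases_zero]; exact measurable_const
  | succ t ih =>
    simp only [purchases_succ]
    exact (ih.mono (ℱ.mono (Nat.le_succ t)) le_rfl).add
      (Measurable.ite (h.measurableSet_purchase t j) measurable_const measurable_const)

theorem stronglyMeasurable_comp_purchases (h : IsTOProcess M d₀ μ ℱ tried bought)
    (f : (ι → ℕ) → ℝ) {s t : ℕ} (hst : s ≤ t) :
    StronglyMeasurable[ℱ t] fun ω => f (purchases d₀ tried bought s ω) :=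
  (((measurable_of_countable f).comp (h.measurable_purchases s)).mono
    (ℱ.mono hst) le_rfl).stronglyMeasurable

end IsTOProcess

/-! ### The random clock and the strong law. -/

section Clock

variable {ι Ω : Type*} [Fintype ι]

/-- The random clock, the sum of the inverse total attractions: it is the common compensator of
the rescaled counts of all the items. -/
noncomputable def marketClock (M : TOMarket ι) (d₀ : ι → ℕ) (tried : ℕ → Ω → ι) (bought : ℕ → Ω → Bool)
    (t : ℕ) (ω : Ω) : ℝ :=
  ∑ s ∈ Finset.range t, 1 / M.attraction (purchases d₀ tried bought s ω)

variable {M : TOMarket ι} {d₀ : ι → ℕ} {tried : ℕ → Ω → ι} {bought : ℕ → Ω → Bool}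

theorem tendsto_marketClock_atTop [Nonempty ι] (hM : ∀ j, 0 < M.v j * M.q j)
    (hr1 : M.r ≤ 1) (hd₀ : ∀ j, 0 < d₀ j) (ω : Ω) :
    Tendsto (fun t => marketClock M d₀ tried bought t ω) atTop atTop := by
  set A := ∑ k, M.v k * (d₀ k : ℝ) with hA
  have hApos : 0 < A := Finset.sum_pos
    (fun k _ => mul_pos (TOMarket.v_pos hM k) (Nat.cast_pos.2 (hd₀ k))) Finset.univ_nonempty
  -- Counts are at least `1`, so `r ≤ 1` makes the attraction at most linear in `s`; the clock
  -- dominates a harmonic series.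
  have hle : ∀ s : ℕ, 1 / A * (1 / ((s : ℝ) + 1)) ≤
      1 / M.attraction (purchases d₀ tried bought s ω) := by
    intro s
    rw [div_mul_div_comm, one_mul]
    refine one_div_le_one_div_of_le (TOMarket.attraction_pos hM (purchases_pos hd₀ s ω)) ?_
    rw [hA, Finset.sum_mul]
    refine Finset.sum_le_sum fun k _ => ?_
    rw [mul_assoc]
    refine mul_le_mul_of_nonneg_left ?_ (M.v_nonneg k)
    have h1 : (1 : ℝ) ≤ purchases d₀ tried bought s ω k :=
      Nat.one_le_cast.2 (purchases_pos hd₀ s ω k)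
    have h2 : (purchases d₀ tried bought s ω k : ℝ) ≤ d₀ k + s := mod_cast purchases_le s ω k
    have h3 : (1 : ℝ) ≤ d₀ k := Nat.one_le_cast.2 (hd₀ k)
    calc _ ≤ (purchases d₀ tried bought s ω k : ℝ) ^ (1 : ℝ) :=
          Real.rpow_le_rpow_of_exponent_le h1 hr1
      _ ≤ d₀ k + s := by rwa [Real.rpow_one]
      _ ≤ d₀ k * (s + 1) := by nlinarith [Nat.cast_nonneg (α := ℝ) s]
  refine tendsto_atTop_mono (fun t => Finset.sum_le_sum fun s _ => hle s) ?_
  simp_rw [← Finset.mul_sum]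
  exact Real.tendsto_sum_range_one_div_nat_succ_atTop.const_mul_atTop (by positivity)

/-- The centred increments of the rescaled count of item `i`, divided by the random clock, are almost
surely summable. -/
theorem IsTOProcess.ae_exists_tendsto_sum_div_marketClock [Nonempty ι] {mΩ : MeasurableSpace Ω}
    {μ : Measure Ω} [IsProbabilityMeasure μ] {ℱ : Filtration ℕ mΩ}
    (h : IsTOProcess M d₀ μ ℱ tried bought) (hM : ∀ j, 0 < M.v j * M.q j) (hr0 : 0 ≤ M.r)
    (hd₀ : ∀ j, 0 < d₀ j) (i : ι) :
    ∀ᵐ ω ∂μ, ∃ L, Tendsto (fun t => ∑ s ∈ Finset.range t,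
      (purchases d₀ tried bought s ω i : ℝ) ^ (-M.r) / marketClock M d₀ tried bought (s + 1) ω *
        ({ω | tried (s + 1) ω = i ∧ bought (s + 1) ω = true}.indicator (fun _ => (1 : ℝ)) ω -
          M.q i * M.tryProb (shareAt d₀ tried bought s ω) i)) atTop (𝓝 L) := by
  set D : ℕ → Ω → ι → ℕ := purchases d₀ tried bought with hD
  set w := M.q i * M.v i with hw
  have hwpos : 0 < w := TOMarket.q_mul_v_pos hM i
  set τ : ℕ → Ω → ℝ := fun s ω => 1 / M.attraction (D s ω) with hτdef
  have hτ : ∀ ω s, 0 < τ s ω := fun ω s =>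
    one_div_pos.2 (TOMarket.attraction_pos hM (purchases_pos hd₀ s ω))
  set T : ℕ → Ω → ℝ := fun t ω => ∑ s ∈ Finset.range t, τ s ω with hT
  have hTpos : ∀ t ω, 0 < T (t + 1) ω := fun t ω =>
    Finset.sum_pos (fun s _ => hτ ω s) (by simp)
  have hτ0 : ∀ ω, τ 0 ω = 1 / M.attraction d₀ := fun ω => by
    simp only [hτdef, hD, purchases_zero]
  have hτ0pos : 0 < 1 / M.attraction d₀ := one_div_pos.2 (TOMarket.attraction_pos hM hd₀)
  set p : ℕ → Ω → ℝ := fun t ω => M.q i * M.tryProb (marketShare (D t ω)) i with hp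
  have hpeq : ∀ t ω, p t ω = w * (D t ω i : ℝ) ^ M.r * τ t ω := fun t ω => by
    simp only [hp, TOMarket.tryProb_marketShare (M := M) (purchases_pos hd₀ t ω), hτdef, hw, hD]
    ring
  set a : ℕ → Ω → ℝ := fun t ω => (D t ω i : ℝ) ^ (-M.r) / T (t + 1) ω with ha
  have hDpos : ∀ t ω, (0 : ℝ) < D t ω i := fun t ω => Nat.cast_pos.2 (purchases_pos hd₀ t ω i)
  have hDone : ∀ t ω, (1 : ℝ) ≤ D t ω i := fun t ω =>
    Nat.one_le_cast.2 (purchases_pos hd₀ t ω i)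
  have hDr : ∀ t ω, (D t ω i : ℝ) ^ (-M.r) * (D t ω i : ℝ) ^ M.r = 1 := fun t ω => by
    rw [← Real.rpow_add (hDpos t ω), neg_add_cancel, Real.rpow_zero]
  have hDle : ∀ t ω, (D t ω i : ℝ) ^ (-M.r) ≤ 1 := fun t ω =>
    Real.rpow_le_one_of_one_le_of_nonpos (hDone t ω) (by linarith)
  have hDnn : ∀ t ω, 0 < (D t ω i : ℝ) ^ (-M.r) := fun t ω => Real.rpow_pos_of_pos (hDpos t ω) _
  exact ae_exists_tendsto_sum_mul_indicator_sub (μ := μ) (ℱ := ℱ)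
    (B := fun t => {ω | tried (t + 1) ω = i ∧ bought (t + 1) ω = true}) (p := p) (a := a)
    -- The clock never falls below its deterministic first increment `1 / M.attraction d₀`, which
    -- gives `C`; `K` is `w` times the bound of `sum_div_sq_partialSum_le`.
    (C := 1 / (1 / M.attraction d₀)) (K := w * (2 / (1 / M.attraction d₀)))
    (fun t => h.measurableSet_purchase t i) (fun t => h.condProb_bought t i)
    (fun t ω => by
      rw [hpeq]
      exact mul_nonneg (mul_nonneg hwpos.le (Real.rpow_nonneg (hDpos t ω).le _)) (hτ ω t).le)
    (fun t ω => by
      have htry : M.tryProb (marketShare (D t ω)) i ≤ 1 := by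
        rw [TOMarket.tryProb_marketShare (purchases_pos hd₀ t ω)]
        refine div_le_one_of_le₀ ?_ (TOMarket.attraction_pos hM (purchases_pos hd₀ t ω)).le
        exact Finset.single_le_sum (f := fun k => M.v k * (D t ω k : ℝ) ^ M.r)
          (fun k _ => mul_nonneg (M.v_nonneg k) (by positivity)) (Finset.mem_univ i)
      exact (mul_le_mul_of_nonneg_left htry (M.q_nonneg i)).trans (by simpa using M.q_le_one i))
    (fun t => h.stronglyMeasurable_comp_purchases
      (fun d => M.q i * M.tryProb (marketShare d) i) le_rfl)
    (fun t => by
      have hTm : StronglyMeasurable[ℱ t] (T (t + 1)) :=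
        Finset.stronglyMeasurable_fun_sum _ fun s hs =>
          h.stronglyMeasurable_comp_purchases (fun d => 1 / M.attraction d)
            (by have := Finset.mem_range.1 hs; omega)
      exact (h.stronglyMeasurable_comp_purchases (fun d => (d i : ℝ) ^ (-M.r)) le_rfl).div₀ hTm
        fun ω => (hTpos t ω).ne')
    (fun t ω => by
      have hTle : 1 / M.attraction d₀ ≤ T (t + 1) ω := by
        rw [← hτ0 ω]
        exact Finset.single_le_sum (f := fun s => τ s ω) (fun s _ => (hτ ω s).le) (by simp)
      rw [abs_of_nonneg (div_nonneg (hDnn t ω).le (hTpos t ω).le)]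
      exact div_le_div₀ zero_le_one (hDle t ω) hτ0pos hTle)
    (fun t ω => by
      rw [← hτ0 ω]
      refine le_trans ?_ (mul_le_mul_of_nonneg_left (sum_div_sq_partialSum_le (τ := fun s => τ s ω) (hτ ω) t) hwpos.le)
      rw [Finset.mul_sum]
      refine Finset.sum_le_sum fun s _ => ?_
      -- One factor `d ^ (-r)` cancels the `d ^ r` in the purchase probability; the other is at most
      -- `1`.
      calc a s ω ^ 2 * p s ω = (D s ω i : ℝ) ^ (-M.r) *
            ((D s ω i : ℝ) ^ (-M.r) * (D s ω i : ℝ) ^ M.r) * (w * (τ s ω / T (s + 1) ω ^ 2)) := by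
            rw [hpeq]; simp only [ha]; ring
        _ ≤ 1 * (w * (τ s ω / T (s + 1) ω ^ 2)) := by
            rw [hDr, mul_one]
            exact mul_le_mul_of_nonneg_right (hDle s ω)
              (mul_nonneg hwpos.le (div_nonneg (hτ ω s).le (sq_nonneg _)))
        _ = _ := one_mul _)

/-- Measured by the random clock, the rescaled count of item `i` grows at the rate `q i * v i`. -/
theorem IsTOProcess.ae_tendsto_integral_div_marketClock [Nonempty ι] {mΩ : MeasurableSpace Ω}
    {μ : Measure Ω} [IsProbabilityMeasure μ] {ℱ : Filtration ℕ mΩ}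
    (h : IsTOProcess M d₀ μ ℱ tried bought) (hM : ∀ j, 0 < M.v j * M.q j) (hr0 : 0 ≤ M.r)
    (hr1 : M.r ≤ 1) (hd₀ : ∀ j, 0 < d₀ j) (i : ι) :
    ∀ᵐ ω ∂μ, Tendsto (fun t => (∫ x in (1 : ℝ)..purchases d₀ tried bought t ω i, x ^ (-M.r)) /
      marketClock M d₀ tried bought t ω) atTop (𝓝 (M.q i * M.v i)) := by
  filter_upwards [h.ae_exists_tendsto_sum_div_marketClock hM hr0 hd₀ i] with ω ⟨L, hL⟩
  set w := M.q i * M.v i with hw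
  set D : ℕ → ℕ := fun t => purchases d₀ tried bought t ω i with hD
  set τ : ℕ → ℝ := fun s => 1 / M.attraction (purchases d₀ tried bought s ω) with hτdef
  set T : ℕ → ℝ := fun t => marketClock M d₀ tried bought t ω with hT
  have hτ : ∀ s, 0 < τ s := fun s =>
    one_div_pos.2 (TOMarket.attraction_pos hM (purchases_pos hd₀ s ω))
  have hTtop : Tendsto T atTop atTop := tendsto_marketClock_atTop hM hr1 hd₀ ω
  have hTpos : ∀ t, 0 < T (t + 1) := fun t => Finset.sum_pos (fun s _ => hτ s) (by simp)
  have hkron := kronecker_tendsto_zero hτ hTtop hL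
  set F : ℕ → ℝ := fun n => ∑ k ∈ Finset.range n, (k : ℝ) ^ (-M.r) with hF
  -- Kronecker's weight cancels the clock in the denominator, leaving the rescaled count minus its
  -- compensator.
  have hsum : ∀ t, ∑ s ∈ Finset.range t, (∑ u ∈ Finset.range (s + 1), τ u) *
      ((D s : ℝ) ^ (-M.r) / T (s + 1) *
        ({ω | tried (s + 1) ω = i ∧ bought (s + 1) ω = true}.indicator (fun _ => (1 : ℝ)) ω -
          M.q i * M.tryProb (shareAt d₀ tried bought s ω) i)) =
      F (D t) - F (d₀ i) - w * T t := by
    intro t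
    rw [hF, ← sum_range_purchases_sub (fun k => (k : ℝ) ^ (-M.r))]
    change _ = _ - w * ∑ s ∈ Finset.range t, τ s
    rw [Finset.mul_sum, ← Finset.sum_sub_distrib]
    refine Finset.sum_congr rfl fun s _ => ?_
    change T (s + 1) * _ = _
    have hDr : (D s : ℝ) ^ (-M.r) * (D s : ℝ) ^ M.r = 1 := by
      rw [← Real.rpow_add (Nat.cast_pos.2 (purchases_pos hd₀ s ω i)), neg_add_cancel,
        Real.rpow_zero]
    have hp : M.q i * M.tryProb (shareAt d₀ tried bought s ω) i = w * (D s : ℝ) ^ M.r * τ s := by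
      rw [shareAt, TOMarket.tryProb_marketShare (purchases_pos hd₀ s ω)]
      simp only [hw, hD, hτdef]
      ring
    rw [hp, ← mul_assoc, mul_div_cancel₀ _ (hTpos s).ne']
    linear_combination (-(w * τ s)) * hDr
  have hkron' : Tendsto (fun t => (F (D t) - F (d₀ i) - w * T t) / T t) atTop (𝓝 0) :=
    hkron.congr fun t => congrArg (· / T t) (hsum t)
  set G : ℕ → ℝ := fun t => ∫ x in (1 : ℝ)..D t, x ^ (-M.r) with hG
  have hbdd : Tendsto (fun t => (G t - F (D t)) / T t) atTop (𝓝 0) := by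
    refine squeeze_zero_norm' ?_ (tendsto_const_nhds (x := (2 : ℝ)) |>.div_atTop hTtop)
    filter_upwards [hTtop.eventually_gt_atTop 0] with t ht
    rw [norm_div, Real.norm_of_nonneg ht.le, Real.norm_eq_abs, abs_sub_comm]
    gcongr
    exact abs_sum_rpow_neg_sub_integral_le hr0 (purchases_pos hd₀ t ω i)
  have hfin := ((hkron'.add hbdd).add
    ((tendsto_const_nhds (x := F (d₀ i))).div_atTop hTtop)).add_const w
  simp only [zero_add] at hfin
  refine hfin.congr' ?_
  filter_upwards [hTtop.eventually_gt_atTop 0] with t ht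
  change _ = G t / T t
  generalize T t = x at *
  field_simp
  ring

end Clock

/-! ### The two limit theorems. -/

theorem mainTheorem1 {ι : Type*} [Fintype ι] [Nonempty ι]
    (M : TOMarket ι) (hM : ∀ j, 0 < M.v j * M.q j) (hr : 0 ≤ M.r)
    (d₀ : ι → ℕ) (hd₀ : ∀ j, 0 < marketShare d₀ j)
    {Ω : Type*} {mΩ : MeasurableSpace Ω} (μ : Measure Ω) [IsProbabilityMeasure μ]
    (ℱ : Filtration ℕ mΩ)
    (tried : ℕ → Ω → ι) (bought : ℕ → Ω → Bool)
    (hproc : IsTOProcess M d₀ μ ℱ tried bought) :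
    (M.r < 1 →
      ∃ φstar : ι → ℝ, M.IsInteriorTOME φstar ∧ (∀ φ, M.IsInteriorTOME φ → φ = φstar) ∧
        ∀ᵐ ω ∂μ, Tendsto (fun t => shareAt d₀ tried bought t ω) atTop (𝓝 φstar)) ∧
    (M.r ≤ 1 →
      ∃ Psistar : ℝ, IsGreatest (M.Psi '' stdSimplex ℝ ι) Psistar ∧
        ∀ᵐ ω ∂μ, Tendsto (fun t => M.Psi (shareAt d₀ tried bought t ω)) atTop (𝓝 Psistar)) := by
  have hd : ∀ j, 0 < d₀ j := fun j => pos_of_marketShare_pos (hd₀ j)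
  have hgrowth : M.r ≤ 1 → ∀ᵐ ω ∂μ, ∀ i, Tendsto (fun t =>
      (∫ x in (1 : ℝ)..purchases d₀ tried bought t ω i, x ^ (-M.r)) /
        marketClock M d₀ tried bought t ω) atTop (𝓝 (M.q i * M.v i)) := fun hr1 =>
    ae_all_iff.2 fun i => hproc.ae_tendsto_integral_div_marketClock hM hr hr1 hd i
  have hclock : M.r ≤ 1 → ∀ ω, Tendsto (fun t => marketClock M d₀ tried bought t ω) atTop atTop :=
    fun hr1 => tendsto_marketClock_atTop hM hr1 hd
  have hshare : M.r < 1 → ∀ᵐ ω ∂μ,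
      Tendsto (fun t => shareAt d₀ tried bought t ω) atTop (𝓝 M.interiorShare) := fun hr1 => by
    filter_upwards [hgrowth hr1.le] with ω hω
    exact tendsto_marketShare_of_rpow_growth hM hr1 (hclock hr1.le ω) hω
  refine ⟨fun hr1 => ⟨M.interiorShare, TOMarket.isInteriorTOME_interiorShare hM hr1,
    fun φ hφ => hφ.eq_interiorShare hM hr1, hshare hr1⟩, fun hr1 => ?_⟩
  rcases hr1.lt_or_eq with hlt | heq
  · refine ⟨M.Psi M.interiorShare,
      ⟨⟨_, TOMarket.interiorShare_mem_stdSimplex hM, rfl⟩, ?_⟩, ?_⟩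
    · rintro _ ⟨φ, hφ, rfl⟩
      exact TOMarket.Psi_le_Psi_interiorShare hM hlt hφ
    · filter_upwards [hshare hlt] with ω hω
      exact (M.continuous_Psi.tendsto _).comp hω
  -- At `r = 1` several items may tie for the largest `q j * v j`; the shares among them need not be
  -- identified, since `Ψ` does not distinguish them.
  · obtain ⟨m, hm⟩ := Finite.exists_max fun j => M.q j * M.v j
    refine ⟨_, TOMarket.isGreatest_Psi_of_r_eq_one hM heq hm, ?_⟩
    filter_upwards [hgrowth hr1] with ω hω
    have hpos := purchases_pos (tried := tried) (bought := bought) hd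
    have hlog : ∀ i, Tendsto (fun t => Real.log (purchases d₀ tried bought t ω i) /
        marketClock M d₀ tried bought t ω) atTop (𝓝 (M.q i * M.v i)) := fun i => by
      refine (hω i).congr fun t => ?_
      simp_rw [heq, Real.rpow_neg_one]
      rw [integral_inv_of_pos one_pos (Nat.cast_pos.2 (hpos t ω i)), div_one]
    exact TOMarket.tendsto_Psi_of_r_eq_one heq hm
      (fun t => marketShare_mem_stdSimplex (hpos t ω))
      fun j hj => tendsto_marketShare_zero_of_log_growth (hclock hr1 ω) (fun t => hpos t ω) hj
        (hlog j) (hlog m)
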